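/- Work in the simply typed $\lambda$-calculus with unification variables, in de Bruijn notation (types are built from atomic types by $\to$; terms are considered modulo $\beta\eta$; unification variables are not affected by $\beta$-reduction and are substituted without capture, by terms of the context of the problem), and in the simply typed $\lambda\sigma$-calculus (rules App, VarCons, Id, Abs, Clos, IdL, IdR, ShiftCons, AssEnv, MapEnv, VarShift, SCons of $\sigma$, together with Beta and Eta) with unification variables $X$ of the sort of terms, each with a sort $(\Gamma_X,T_X)$, meaning $\Gamma_X\vdash X:T_X$, and infinitely many of each sort. In a context $A.\Gamma$ the index $1$ has type $A$. A substitution maps every unification variable of the $\lambda\sigma$-calculus to a term of the same sort and is applied by first-order replacement. Let $a=b$ be a unification problem of the $\lambda$-calculus, i.e. $a$ and $b$ are $\lambda$-terms of the same type in the same context $\Gamma$ (in particular, $a=b$ may be any second-order unification problem; no bound on the order is needed). Let $a_F,b_F$ be the precookings of $a,b$: the index $k$ is translated to $1[\uparrow^{k-1}]$, and a unification variable $X$ of type $A$ occurring below $n$ binders to $X[\uparrow^n]$, with $X$ of sort $(\Gamma,A)$. Let $\sigma$ be the substitution mapping every variable $X$ of sort $(\Gamma, A_1\to\dots\to A_n\to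 B)$, $B$ atomic, occurring in $a_F=b_F$, to $\lambda_{A_1}\dots\lambda_{A_n}Y_X$, where the $Y_X$ are new, pairwise distinct variables, $Y_X$ of sort $(A_n.\,\cdots.A_1.\Gamma,\ B)$, and fixing all other variables. Let $\tilde a$ and $\tilde b$ be $\lambda\sigma$-normal forms of $\sigma a_F$ and $\sigma b_F$. Call a $\lambda\sigma$-term simple if each of its subterms $X[s]$, with $X$ a unification variable, has $s=\uparrow^n$ for some $n\ge 0$ (where $\uparrow^0=\mathrm{id}$, $\uparrow^1=\uparrow$, $\uparrow^{n+1}=\uparrow\circ\uparrow^n$), and a substitution $\theta$ simple if $\theta X$ is simple for every $X$. Then the following are equivalent: (i) $a=b$ has a solution in the $\lambda$-calculus, i.e. $\theta a=_{\beta\eta}\theta b$ for some substitution $\theta$ of terms of context $\Gamma$ for the unification variables; (ii) $\tilde a=\tilde b$ has a simple solution, i.e. $\theta\tilde a=_{\lambda\sigma}\theta\tilde b$ for some simple $\theta$; (iii) $\tilde a=\tilde b$ has a simple solution $\theta$ such that every $\theta X$ is moreover $\sigma$-normal (so that its only closures are of the forms $1[\uparrow^n]$ and $X[\uparrow^n]$).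 -/

import Mathlib

namespace LambdaSigma

universe u

/-- Simple types over a set `ι` of atomic types. -/
inductive Ty (ι : Type u) : Type u
  | base : ι → Ty ι
  | arr : Ty ι → Ty ι → Ty ι

/-- Contexts; the head of the list is the type of the de Bruijn index `1`, so `A :: Γ` is the
context written `A.Γ`. -/
abbrev Ctx (ι : Type u) : Type u := List (Ty ι)

/-- The atomic type `B` of `A₁ → ⋯ → Aₙ → B`. -/
def Ty.target {ι : Type u} : Ty ι → ι
  | .base i => i
  | .arr _ B => B.target

/-- For `A = A₁ → ⋯ → Aₙ → B` with `B` atomic, the context `Aₙ. ⋯ .A₁.Γ` of the body of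
`λ_{A₁} ⋯ λ_{Aₙ}` in `Γ`. -/
def Ty.bodyCtx {ι : Type u} : Ty ι → Ctx ι → Ctx ι
  | .base _, Γ => Γ
  | .arr A B, Γ => B.bodyCtx (A :: Γ)

/-! ### Simply typed `λ`-calculus with unification variables, in de Bruijn notation -/

/-- `Var Γ A`: the de Bruijn indices of type `A` in `Γ` (`zero` is the index `1`). -/
inductive Var {ι : Type u} : Ctx ι → Ty ι → Type u
  | zero {Γ : Ctx ι} {A : Ty ι} : Var (A :: Γ) A
  | succ {Γ : Ctx ι} {A B : Ty ι} : Var Γ A → Var (B :: Γ) A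

/-- Well-typed `λ`-terms of type `A` in the context `Γ`.  `mvar n : Term Γ A` is the unification
variable with name `n` and type `A` (there are infinitely many of each type). It stands for a term
of the ambient context of the problem and is not affected by `β`-reduction. -/
inductive Term {ι : Type u} : Ctx ι → Ty ι → Type u
  | var {Γ : Ctx ι} {A : Ty ι} : Var Γ A → Term Γ A
  | mvar {Γ : Ctx ι} {A : Ty ι} : ℕ → Term Γ A
  | app {Γ : Ctx ι} {A B : Ty ι} : Term Γ (.arr A B) → Term Γ A → Term Γ B
  | lam {Γ : Ctx ι} {A B : Ty ι} : Term (A :: Γ) B → Term Γ (.arr A B)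

def liftRen {ι : Type u} {Γ Δ : Ctx ι} (ρ : ∀ A, Var Γ A → Var Δ A) (B : Ty ι) :
    ∀ A, Var (B :: Γ) A → Var (B :: Δ) A
  | _, .zero => .zero
  | _, .succ x => .succ (ρ _ x)

def Term.rename {ι : Type u} {Γ : Ctx ι} {A : Ty ι} :
    Term Γ A → {Δ : Ctx ι} → (∀ A, Var Γ A → Var Δ A) → Term Δ A
  | .var x, _, ρ => .var (ρ _ x)
  | .mvar n, _, _ => .mvar n
  | .app a b, _, ρ => .app (a.rename ρ) (b.rename ρ)
  | .lam a, _, ρ => .lam (a.rename (liftRen ρ _))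

/-- The lifting `a⁺`. -/
def Term.weaken {ι : Type u} {Γ : Ctx ι} {A : Ty ι} (B : Ty ι) (a : Term Γ A) :
    Term (B :: Γ) A :=
  a.rename fun _ x => .succ x

def liftSub {ι : Type u} {Γ Δ : Ctx ι} (τ : ∀ A, Var Γ A → Term Δ A) (B : Ty ι) :
    ∀ A, Var (B :: Γ) A → Term (B :: Δ) A
  | _, .zero => .var .zero
  | _, .succ x => (τ _ x).weaken B

/-- Simultaneous capture-avoiding substitution for the de Bruijn indices. -/
def Term.subst {ι : Type u} {Γ : Ctx ι} {A : Ty ι} :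
    Term Γ A → {Δ : Ctx ι} → (∀ A, Var Γ A → Term Δ A) → Term Δ A
  | .var x, _, τ => τ _ x
  | .mvar n, _, _ => .mvar n
  | .app a b, _, τ => .app (a.subst τ) (b.subst τ)
  | .lam a, _, τ => .lam (a.subst (liftSub τ _))

def single {ι : Type u} {Γ : Ctx ι} {B : Ty ι} (b : Term Γ B) : ∀ A, Var (B :: Γ) A → Term Γ A
  | _, .zero => b
  | _, .succ x => .var x

/-- One step of `βη`-reduction. -/
inductive BetaEta {ι : Type u} : {Γ : Ctx ι} → {A : Ty ι} → Term Γ A → Term Γ A → Prop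
  | beta {Γ : Ctx ι} {A B : Ty ι} (a : Term (A :: Γ) B) (b : Term Γ A) :
      BetaEta (.app (.lam a) b) (a.subst (single b))
  | eta {Γ : Ctx ι} {A B : Ty ι} (a : Term Γ (.arr A B)) :
      BetaEta (.lam (.app (a.weaken A) (.var .zero))) a
  | appL {Γ : Ctx ι} {A B : Ty ι} {a a' : Term Γ (.arr A B)} (b : Term Γ A) :
      BetaEta a a' → BetaEta (.app a b) (.app a' b)
  | appR {Γ : Ctx ι} {A B : Ty ι} (a : Term Γ (.arr A B)) {b b' : Term Γ A} :
      BetaEta b b' → BetaEta (.app a b) (.app a b')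
  | lam {Γ : Ctx ι} {A B : Ty ι} {a a' : Term (A :: Γ) B} :
      BetaEta a a' → BetaEta (.lam a) (.lam a')

/-- `βη`-equality of `λ`-terms. -/
def BetaEtaConv {ι : Type u} {Γ : Ctx ι} {A : Ty ι} (a b : Term Γ A) : Prop :=
  Relation.EqvGen BetaEta a b

/-- `Wk Δ Γ`: `Δ` is obtained from `Γ` by adding types in front; `Δ` is the local context below
the binders crossed so far, inside a term of context `Γ`. -/
inductive Wk {ι : Type u} (Γ : Ctx ι) : Ctx ι → Type u
  | nil : Wk Γ Γ
  | cons {Δ : Ctx ι} {A : Ty ι} : Wk Γ Δ → Wk Γ (A :: Δ)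

def Wk.ren {ι : Type u} {Γ Δ : Ctx ι} : Wk Γ Δ → ∀ A, Var Γ A → Var Δ A
  | .nil, _, x => x
  | .cons w, _, x => .succ (w.ren _ x)

/-- Application of a substitution `θ` of terms of context `Γ` for the unification variables of a
term; `θ` is lifted whenever a binder is crossed, so there is no capture. -/
def Term.inst {ι : Type u} {Γ : Ctx ι} (θ : ∀ A : Ty ι, ℕ → Term Γ A) {Δ : Ctx ι} {A : Ty ι} :
    Term Δ A → Wk Γ Δ → Term Δ A
  | .var x, _ => .var x
  | .mvar n, w => (θ _ n).rename w.ren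
  | .app a b, w => .app (a.inst θ w) (b.inst θ w)
  | .lam a, w => .lam (a.inst θ (.cons w))

/-- The unification problem `a = b` of the `λ`-calculus, in the context `Γ`, has a solution. -/
def HasSolution {ι : Type u} {Γ : Ctx ι} {T : Ty ι} (a b : Term Γ T) : Prop :=
  ∃ θ : ∀ A : Ty ι, ℕ → Term Γ A, BetaEtaConv (a.inst θ .nil) (b.inst θ .nil)

/-! ### The simply typed `λσ`-calculus with unification variables of the sort of terms -/

/-- In a context, an expression is either a term of some type or an explicit substitution with
some codomain context. -/
inductive Kind (ι : Type u) : Type u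
  | tm : Ty ι → Kind ι
  | sub : Ctx ι → Kind ι

/-- Well-typed expressions of the `λσ`-calculus.  `Expr Γ (.tm A)` are the terms `a` with
`Γ ⊢ a : A` and `Expr Γ (.sub Δ)` the substitutions `s` with `Γ ⊢ s ▷ Δ`.
`mvar n : Expr Γ (.tm A)` is the unification variable with name `n` and sort `(Γ, A)`
(there are infinitely many of each sort). -/
inductive Expr {ι : Type u} : Ctx ι → Kind ι → Type u
  /-- the index `1` -/
  | one {Γ : Ctx ι} {A : Ty ι} : Expr (A :: Γ) (.tm A)
  | mvar {Γ : Ctx ι} {A : Ty ι} : ℕ → Expr Γ (.tm A)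
  | app {Γ : Ctx ι} {A B : Ty ι} :
      Expr Γ (.tm (.arr A B)) → Expr Γ (.tm A) → Expr Γ (.tm B)
  | lam {Γ : Ctx ι} {A B : Ty ι} : Expr (A :: Γ) (.tm B) → Expr Γ (.tm (.arr A B))
  /-- the closure `a[s]` -/
  | clos {Γ Δ : Ctx ι} {A : Ty ι} : Expr Δ (.tm A) → Expr Γ (.sub Δ) → Expr Γ (.tm A)
  | id {Γ : Ctx ι} : Expr Γ (.sub Γ)
  /-- the shift `↑` -/
  | shift {Γ : Ctx ι} {A : Ty ι} : Expr (A :: Γ) (.sub Γ)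
  /-- `a.s` -/
  | cons {Γ Δ : Ctx ι} {A : Ty ι} :
      Expr Γ (.tm A) → Expr Γ (.sub Δ) → Expr Γ (.sub (A :: Δ))
  /-- `s ∘ t` (first `s`, then `t`) -/
  | comp {Γ Δ Θ : Ctx ι} : Expr Δ (.sub Θ) → Expr Γ (.sub Δ) → Expr Γ (.sub Θ)

/-- The rules of `σ`. -/
inductive SigmaRule {ι : Type u} : (Γ : Ctx ι) → (k : Kind ι) → Expr Γ k → Expr Γ k → Prop
  | app {Γ Δ : Ctx ι} {A B : Ty ι} (a : Expr Δ (.tm (.arr A B))) (b : Expr Δ (.tm A))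
      (s : Expr Γ (.sub Δ)) :
      SigmaRule _ _ (.clos (.app a b) s) (.app (.clos a s) (.clos b s))
  | varCons {Γ Δ : Ctx ι} {A : Ty ι} (a : Expr Γ (.tm A)) (s : Expr Γ (.sub Δ)) :
      SigmaRule _ _ (.clos .one (.cons a s)) a
  | id {Γ : Ctx ι} {A : Ty ι} (a : Expr Γ (.tm A)) : SigmaRule _ _ (.clos a .id) a
  | abs {Γ Δ : Ctx ι} {A B : Ty ι} (a : Expr (A :: Δ) (.tm B)) (s : Expr Γ (.sub Δ)) :
      SigmaRule _ _ (.clos (.lam a) s) (.lam (.clos a (.cons .one (.comp s .shift))))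
  | clos {Γ Δ Θ : Ctx ι} {A : Ty ι} (a : Expr Θ (.tm A)) (s : Expr Δ (.sub Θ))
      (t : Expr Γ (.sub Δ)) :
      SigmaRule _ _ (.clos (.clos a s) t) (.clos a (.comp s t))
  | idL {Γ Δ : Ctx ι} (s : Expr Γ (.sub Δ)) : SigmaRule _ _ (.comp .id s) s
  | idR {Γ Δ : Ctx ι} (s : Expr Γ (.sub Δ)) : SigmaRule _ _ (.comp s .id) s
  | shiftCons {Γ Δ : Ctx ι} {A : Ty ι} (a : Expr Γ (.tm A)) (s : Expr Γ (.sub Δ)) :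
      SigmaRule _ _ (.comp .shift (.cons a s)) s
  | assEnv {Γ Δ Θ Ξ : Ctx ι} (s : Expr Θ (.sub Ξ)) (t : Expr Δ (.sub Θ))
      (r : Expr Γ (.sub Δ)) :
      SigmaRule _ _ (.comp (.comp s t) r) (.comp s (.comp t r))
  | mapEnv {Γ Δ Θ : Ctx ι} {A : Ty ι} (a : Expr Δ (.tm A)) (s : Expr Δ (.sub Θ))
      (t : Expr Γ (.sub Δ)) :
      SigmaRule _ _ (.comp (.cons a s) t) (.cons (.clos a t) (.comp s t))
  | varShift {Γ : Ctx ι} {A : Ty ι} :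
      SigmaRule (A :: Γ) (.sub (A :: Γ)) (.cons .one .shift) .id
  | sCons {Γ Δ : Ctx ι} {A : Ty ι} (s : Expr Γ (.sub (A :: Δ))) :
      SigmaRule _ _ (.cons (.clos .one s) (.comp .shift s)) s

/-- One-step rewriting at an arbitrary position, by the rules `R`. -/
inductive Step {ι : Type u} (R : (Γ : Ctx ι) → (k : Kind ι) → Expr Γ k → Expr Γ k → Prop) :
    {Γ : Ctx ι} → {k : Kind ι} → Expr Γ k → Expr Γ k → Prop
  | root {Γ : Ctx ι} {k : Kind ι} {e e' : Expr Γ k} : R Γ k e e' → Step R e e'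
  | appL {Γ : Ctx ι} {A B : Ty ι} {a a' : Expr Γ (.tm (.arr A B))} (b : Expr Γ (.tm A)) :
      Step R a a' → Step R (.app a b) (.app a' b)
  | appR {Γ : Ctx ι} {A B : Ty ι} (a : Expr Γ (.tm (.arr A B))) {b b' : Expr Γ (.tm A)} :
      Step R b b' → Step R (.app a b) (.app a b')
  | lam {Γ : Ctx ι} {A B : Ty ι} {a a' : Expr (A :: Γ) (.tm B)} :
      Step R a a' → Step R (.lam a) (.lam a')
  | closL {Γ Δ : Ctx ι} {A : Ty ι} {a a' : Expr Δ (.tm A)} (s : Expr Γ (.sub Δ)) :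
      Step R a a' → Step R (.clos a s) (.clos a' s)
  | closR {Γ Δ : Ctx ι} {A : Ty ι} (a : Expr Δ (.tm A)) {s s' : Expr Γ (.sub Δ)} :
      Step R s s' → Step R (.clos a s) (.clos a s')
  | consL {Γ Δ : Ctx ι} {A : Ty ι} {a a' : Expr Γ (.tm A)} (s : Expr Γ (.sub Δ)) :
      Step R a a' → Step R (.cons a s) (.cons a' s)
  | consR {Γ Δ : Ctx ι} {A : Ty ι} (a : Expr Γ (.tm A)) {s s' : Expr Γ (.sub Δ)} :
      Step R s s' → Step R (.cons a s) (.cons a s')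
  | compL {Γ Δ Θ : Ctx ι} {s s' : Expr Δ (.sub Θ)} (t : Expr Γ (.sub Δ)) :
      Step R s s' → Step R (.comp s t) (.comp s' t)
  | compR {Γ Δ Θ : Ctx ι} (s : Expr Δ (.sub Θ)) {t t' : Expr Γ (.sub Δ)} :
      Step R t t' → Step R (.comp s t) (.comp s t')

/-- `σ`-equality. -/
def SigmaConv {ι : Type u} {Γ : Ctx ι} {k : Kind ι} (e e' : Expr Γ k) : Prop :=
  Relation.EqvGen (Step SigmaRule) e e'

/-- The rules of `λσ`: those of `σ`, Beta and Eta. -/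
inductive LambdaSigmaRule {ι : Type u} :
    (Γ : Ctx ι) → (k : Kind ι) → Expr Γ k → Expr Γ k → Prop
  | sigma {Γ : Ctx ι} {k : Kind ι} {e e' : Expr Γ k} :
      SigmaRule Γ k e e' → LambdaSigmaRule Γ k e e'
  | beta {Γ : Ctx ι} {A B : Ty ι} (a : Expr (A :: Γ) (.tm B)) (b : Expr Γ (.tm A)) :
      LambdaSigmaRule _ _ (.app (.lam a) b) (.clos a (.cons b .id))
  | eta {Γ : Ctx ι} {A B : Ty ι} (a : Expr (A :: Γ) (.tm (.arr A B)))
      (b : Expr Γ (.tm (.arr A B))) :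
      SigmaConv a (.clos b .shift) → LambdaSigmaRule _ _ (.lam (.app a .one)) b

/-- `λσ`-equality. -/
def LambdaSigmaConv {ι : Type u} {Γ : Ctx ι} {k : Kind ι} (e e' : Expr Γ k) : Prop :=
  Relation.EqvGen (Step LambdaSigmaRule) e e'

/-- `e'` is a `λσ`-normal form of `e`. -/
def IsNormalForm {ι : Type u} {Γ : Ctx ι} {k : Kind ι} (e e' : Expr Γ k) : Prop :=
  Relation.ReflTransGen (Step LambdaSigmaRule) e e' ∧ ∀ e'', ¬ Step LambdaSigmaRule e' e''

/-- `e` is irreducible for `σ`. -/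
def IsSigmaNormal {ι : Type u} {Γ : Ctx ι} {k : Kind ι} (e : Expr Γ k) : Prop :=
  ∀ e', ¬ Step SigmaRule e e'

/-- A substitution for the unification variables, mapping every variable of sort `(Γ, A)` to a
term of type `A` in `Γ`. -/
abbrev Grafting (ι : Type u) : Type u := ∀ (Γ : Ctx ι) (A : Ty ι), ℕ → Expr Γ (.tm A)

/-- Replacement of the unification variables (first-order: explicit substitutions take care of
the binders). -/
def Expr.graft {ι : Type u} (θ : Grafting ι) {Γ : Ctx ι} {k : Kind ι} : Expr Γ k → Expr Γ k
  | .one => .one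
  | .mvar n => θ _ _ n
  | .app a b => .app (a.graft θ) (b.graft θ)
  | .lam a => .lam (a.graft θ)
  | .clos a s => .clos (a.graft θ) (s.graft θ)
  | .id => .id
  | .shift => .shift
  | .cons a s => .cons (a.graft θ) (s.graft θ)
  | .comp s t => .comp (s.graft θ) (t.graft θ)

/-- `θ` is a solution of the `λσ`-unification problem `a = b`. -/
def Solves {ι : Type u} {Γ : Ctx ι} {T : Ty ι} (θ : Grafting ι) (a b : Expr Γ (.tm T)) : Prop :=
  LambdaSigmaConv (a.graft θ) (b.graft θ)

/-- `IsShiftPow n s`: the substitution `s` is `↑ⁿ`, where `↑⁰ = id`, `↑¹ = ↑` and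
`↑ⁿ⁺¹ = ↑ ∘ ↑ⁿ`. -/
inductive IsShiftPow {ι : Type u} : ℕ → {Γ Δ : Ctx ι} → Expr Γ (.sub Δ) → Prop
  | zero {Γ : Ctx ι} : IsShiftPow 0 (.id : Expr Γ (.sub Γ))
  | one {Γ : Ctx ι} {A : Ty ι} : IsShiftPow 1 (.shift : Expr (A :: Γ) (.sub Γ))
  | succ {n : ℕ} {Γ Δ : Ctx ι} {A : Ty ι} {s : Expr Γ (.sub (A :: Δ))} :
      IsShiftPow (n + 1) s → IsShiftPow (n + 2) (.comp .shift s)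

def Expr.IsMVar {ι : Type u} {Γ : Ctx ι} {k : Kind ι} : Expr Γ k → Prop
  | .mvar _ => True
  | _ => False

/-- An expression is simple if each of its subterms `X[s]`, with `X` a unification variable, is
such that `s = ↑ⁿ` for some `n`. -/
def Expr.IsSimple {ι : Type u} {Γ : Ctx ι} {k : Kind ι} : Expr Γ k → Prop
  | .one => True
  | .mvar _ => True
  | .app a b => a.IsSimple ∧ b.IsSimple
  | .lam a => a.IsSimple
  | .clos a s => (a.IsMVar → ∃ n, IsShiftPow n s) ∧ a.IsSimple ∧ s.IsSimple
  | .id => True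
  | .shift => True
  | .cons a s => a.IsSimple ∧ s.IsSimple
  | .comp s t => s.IsSimple ∧ t.IsSimple

/-- A substitution for the unification variables is simple if all its values are. -/
def Grafting.IsSimple {ι : Type u} (θ : Grafting ι) : Prop :=
  ∀ (Γ : Ctx ι) (A : Ty ι) (n : ℕ), (θ Γ A n).IsSimple

/-- A unification variable of the `λσ`-calculus: a name and a sort `(ctx, ty)`. -/
structure MVar (ι : Type u) : Type u where
  name : ℕ
  ctx : Ctx ι
  ty : Ty ι

/-- The unification variables that occur in an expression. -/
def Expr.mvars {ι : Type u} {Γ : Ctx ι} {k : Kind ι} : Expr Γ k → Set (MVar ι)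
  | .one => ∅
  | .mvar (Γ := Γ) (A := A) n => {⟨n, Γ, A⟩}
  | .app a b => a.mvars ∪ b.mvars
  | .lam a => a.mvars
  | .clos a s => a.mvars ∪ s.mvars
  | .id => ∅
  | .shift => ∅
  | .cons a s => a.mvars ∪ s.mvars
  | .comp s t => s.mvars ∪ t.mvars

/-! ### Precooking -/

/-- The index `1 + k` of a context `Γ`, read through `s`: the term `1[↑ᵏ ∘ s]`. -/
def varShift {ι : Type u} {Γ : Ctx ι} {A : Ty ι} :
    Var Γ A → {Θ : Ctx ι} → Expr Θ (.sub Γ) → Expr Θ (.tm A)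
  | .zero, _, s => .clos .one s
  | .succ x, _, s => varShift x (.comp .shift s)

/-- The index `1 + k` as the `λσ`-term `1[↑ᵏ]`, with `1[↑⁰] = 1`. -/
def precookVar {ι : Type u} {Γ : Ctx ι} {A : Ty ι} : Var Γ A → Expr Γ (.tm A)
  | .zero => .one
  | .succ x => varShift x .shift

/-- For `Δ` that extends `Γ` by `n` types, the substitution `↑ⁿ ∘ s`, nested to the right. -/
def wkShift {ι : Type u} {Γ Δ : Ctx ι} : Wk Γ Δ → {Θ : Ctx ι} → Expr Θ (.sub Δ) → Expr Θ (.sub Γ)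
  | .nil, _, s => s
  | .cons w, _, s => wkShift w (.comp .shift s)

/-- The unification variable of name `m` and sort `(Γ, A)` below `n` binders: the term `X[↑ⁿ]`,
with `X[↑⁰] = X`. -/
def precookMVar {ι : Type u} {Γ Δ : Ctx ι} {A : Ty ι} (m : ℕ) : Wk Γ Δ → Expr Δ (.tm A)
  | .nil => .mvar m
  | .cons w => .clos (.mvar m : Expr Γ (.tm A)) (wkShift w .shift)

/-- Precooking `F`, with the binders crossed so far as an argument. -/
def precookAux {ι : Type u} {Γ Δ : Ctx ι} {A : Ty ι} : Term Δ A → Wk Γ Δ → Expr Δ (.tm A)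
  | .var x, _ => precookVar x
  | .mvar m, w => precookMVar m w
  | .app a b, w => .app (precookAux a w) (precookAux b w)
  | .lam a, w => .lam (precookAux a (.cons w))

/-- The precooking `a_F` of a `λ`-term `a` of context `Γ`; a unification variable of type `A` becomes
one of sort `(Γ, A)`. -/
def precook {ι : Type u} {Γ : Ctx ι} {A : Ty ι} (a : Term Γ A) : Expr Γ (.tm A) :=
  precookAux a .nil

/-! ### The substitution `X ↦ λ ⋯ λ Y` -/

/-- For `A = A₁ → ⋯ → Aₙ → B` with `B` atomic, the term `λ_{A₁} ⋯ λ_{Aₙ} c`. -/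
def lams {ι : Type u} : (A : Ty ι) → {Γ : Ctx ι} →
    Expr (A.bodyCtx Γ) (.tm (.base A.target)) → Expr Γ (.tm A)
  | .base _, _, c => c
  | .arr _ B, _, c => .lam (lams B c)

/-- For `X` of sort `(Γ, A₁ → ⋯ → Aₙ → B)` with `B` atomic, the variable `Y` of sort
`(Aₙ. ⋯ .A₁.Γ, B)` whose name is `y X`. -/
def bodyVar {ι : Type u} (y : MVar ι → ℕ) (X : MVar ι) : MVar ι :=
  ⟨y X, X.ty.bodyCtx X.ctx, .base X.ty.target⟩

/-- The choice `y` of names gives new and pairwise distinct variables to the elements of `V`. -/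
def IsFresh {ι : Type u} (y : MVar ι → ℕ) (V : Set (MVar ι)) : Prop :=
  Set.InjOn (bodyVar y) V ∧ ∀ X ∈ V, bodyVar y X ∉ V

open Classical in
/-- The substitution that maps each variable `X` in `V` to `λ ⋯ λ Y` with `Y = bodyVar y X`, and
each other variable to itself. -/
noncomputable def expand {ι : Type u} (y : MVar ι → ℕ) (V : Set (MVar ι)) : Grafting ι :=
  fun Γ A n => if (⟨n, Γ, A⟩ : MVar ι) ∈ V then lams A (.mvar (y ⟨n, Γ, A⟩)) else .mvar n

end LambdaSigma

open LambdaSigma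

namespace LambdaSigma

universe u

variable {ι : Type u}

/-! ### Substitution calculus of the `λ`-terms -/

/-! The two calculi are linked by maps in both directions. From `λσ` to `λ`, `Expr.eval` carries out
all explicit substitutions and reads `X[s]` as `X`. The rules of `σ` become identities of terms,
Beta and Eta become `βη`-steps, and grafting into a precooked term becomes capture-free
instantiation (`eval_graft_precookAux`). So a solution `θ` of the normalised problem, composed with
the expansion `X ↦ λ⋯λ Y`, solves the precooked problem and evaluates to a solution in the
`λ`-calculus.

From `λ` to `λσ`, precooking respects `βη` (`BetaEtaConv.precook`) and turns instantiation into
grafting (`graft_precookAux`). Given a solution `τ`, send `Y_X` to the precooked body of the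
`η`-expansion of `τ X`. Abstracting it again gives the precooking of `τ X` up to Eta
(`lams_precookAux_etaBody`), so this solves the expanded problem. Precooked terms contain only the
closures `1[↑ⁿ]` and `X[↑ⁿ]` with `n ≥ 1`, hence are simple and `σ`-normal
(`isSimple_isSigmaNormal_precookAux`). Since conversion is stable under grafting, passing to normal
forms changes nothing. -/

theorem liftRen_comp {Γ Δ Θ : Ctx ι} (ρ : ∀ A, Var Γ A → Var Δ A) (ρ' : ∀ A, Var Δ A → Var Θ A)
    (B : Ty ι) :
    (fun A x => liftRen ρ' B A (liftRen ρ B A x)) = liftRen (fun A x => ρ' A (ρ A x)) B := by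
  funext A x; cases x <;> rfl

theorem Term.rename_rename {Γ : Ctx ι} {A : Ty ι} (a : Term Γ A) {Δ Θ : Ctx ι}
    (ρ : ∀ A, Var Γ A → Var Δ A) (ρ' : ∀ A, Var Δ A → Var Θ A) :
    (a.rename ρ).rename ρ' = a.rename fun A x => ρ' A (ρ A x) := by
  induction a generalizing Δ Θ with
  | var x => rfl
  | mvar n => rfl
  | app a b iha ihb => simp only [Term.rename, iha, ihb]
  | lam a ih => simp only [Term.rename, ih, liftRen_comp]

theorem liftSub_liftRen {Γ Δ Θ : Ctx ι} (ρ : ∀ A, Var Γ A → Var Δ A)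
    (τ : ∀ A, Var Δ A → Term Θ A) (B : Ty ι) :
    (fun A x => liftSub τ B A (liftRen ρ B A x)) = liftSub (fun A x => τ A (ρ A x)) B := by
  funext A x; cases x <;> rfl

theorem Term.subst_rename {Γ : Ctx ι} {A : Ty ι} (a : Term Γ A) {Δ Θ : Ctx ι}
    (ρ : ∀ A, Var Γ A → Var Δ A) (τ : ∀ A, Var Δ A → Term Θ A) :
    (a.rename ρ).subst τ = a.subst fun A x => τ A (ρ A x) := by
  induction a generalizing Δ Θ with
  | var x => rfl
  | mvar n => rfl
  | app a b iha ihb => simp only [Term.rename, Term.subst, iha, ihb]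
  | lam a ih => simp only [Term.rename, Term.subst, ih, liftSub_liftRen]

theorem rename_liftSub {Γ Δ Θ : Ctx ι} (τ : ∀ A, Var Γ A → Term Δ A)
    (ρ : ∀ A, Var Δ A → Var Θ A) (B : Ty ι) :
    (fun A x => (liftSub τ B A x).rename (liftRen ρ B)) =
      liftSub (fun A x => (τ A x).rename ρ) B := by
  funext A x
  cases x with
  | zero => rfl
  | succ x => simp only [liftSub, Term.weaken, Term.rename_rename, liftRen]

/-- Crossing a binder weakens the values of `τ`, and weakening is a renaming; so laws for
substitutions rest on those already proved for renamings. -/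
theorem Term.rename_subst {Γ : Ctx ι} {A : Ty ι} (a : Term Γ A) {Δ Θ : Ctx ι}
    (τ : ∀ A, Var Γ A → Term Δ A) (ρ : ∀ A, Var Δ A → Var Θ A) :
    (a.subst τ).rename ρ = a.subst fun A x => (τ A x).rename ρ := by
  induction a generalizing Δ Θ with
  | var x => rfl
  | mvar n => rfl
  | app a b iha ihb => simp only [Term.rename, Term.subst, iha, ihb]
  | lam a ih => simp only [Term.rename, Term.subst, ih, rename_liftSub]

theorem Term.weaken_subst {Γ Δ : Ctx ι} {A : Ty ι} (a : Term Γ A)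
    (τ : ∀ A, Var Γ A → Term Δ A) (B : Ty ι) :
    (a.weaken B).subst (liftSub τ B) = (a.subst τ).weaken B := by
  simp only [Term.weaken, Term.subst_rename, Term.rename_subst, liftSub]

theorem subst_liftSub {Γ Δ Θ : Ctx ι} (τ : ∀ A, Var Γ A → Term Δ A)
    (τ' : ∀ A, Var Δ A → Term Θ A) (B : Ty ι) :
    (fun A x => (liftSub τ B A x).subst (liftSub τ' B)) =
      liftSub (fun A x => (τ A x).subst τ') B := by
  funext A x
  cases x with
  | zero => rfl
  | succ x => simp only [liftSub, Term.weaken_subst]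

theorem Term.subst_subst {Γ : Ctx ι} {A : Ty ι} (a : Term Γ A) {Δ Θ : Ctx ι}
    (τ : ∀ A, Var Γ A → Term Δ A) (τ' : ∀ A, Var Δ A → Term Θ A) :
    (a.subst τ).subst τ' = a.subst fun A x => (τ A x).subst τ' := by
  induction a generalizing Δ Θ with
  | var x => rfl
  | mvar n => rfl
  | app a b iha ihb => simp only [Term.subst, iha, ihb]
  | lam a ih => simp only [Term.subst, ih, subst_liftSub]

theorem liftSub_var {Γ Δ : Ctx ι} (ρ : ∀ A, Var Γ A → Var Δ A) (B : Ty ι) :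
    liftSub (fun A x => .var (ρ A x)) B = fun A x => .var (liftRen ρ B A x) := by
  funext A x; cases x <;> rfl

theorem Term.rename_eq_subst {Γ : Ctx ι} {A : Ty ι} (a : Term Γ A) {Δ : Ctx ι}
    (ρ : ∀ A, Var Γ A → Var Δ A) : a.rename ρ = a.subst fun A x => .var (ρ A x) := by
  induction a generalizing Δ with
  | var x => rfl
  | mvar n => rfl
  | app a b iha ihb => simp only [Term.rename, Term.subst, iha, ihb]
  | lam a ih => simp only [Term.rename, Term.subst, ih, liftSub_var]

theorem liftRen_id {Γ : Ctx ι} (B : Ty ι) :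
    liftRen (fun A (x : Var Γ A) => x) B = fun _ x => x := by
  funext A x; cases x <;> rfl

theorem Term.rename_id {Γ : Ctx ι} {A : Ty ι} (a : Term Γ A) : (a.rename fun _ x => x) = a := by
  induction a with
  | var x => rfl
  | mvar n => rfl
  | app a b iha ihb => simp only [Term.rename, iha, ihb]
  | lam a ih => simp only [Term.rename, liftRen_id, ih]

theorem Term.subst_var {Γ : Ctx ι} {A : Ty ι} (a : Term Γ A) : (a.subst fun _ x => .var x) = a := by
  rw [← Term.rename_eq_subst (ρ := fun _ x => x), Term.rename_id]

/-- The substitution lemma; it makes a `β`-step stable under substitution. -/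
theorem Term.subst_single_subst {Γ Δ : Ctx ι} {A B : Ty ι} (a : Term (A :: Γ) B) (b : Term Γ A)
    (τ : ∀ A, Var Γ A → Term Δ A) :
    (a.subst (liftSub τ A)).subst (single (b.subst τ)) = (a.subst (single b)).subst τ := by
  simp only [Term.subst_subst]
  congr 1
  funext C x
  cases x with
  | zero => rfl
  | succ x => simp only [liftSub, single, Term.weaken, Term.subst_rename, Term.subst,
      Term.subst_var]

/-! ### `βη`-equality is a congruence -/

theorem eqvGen_lift {α β : Type*} {r : α → α → Prop} {r' : β → β → Prop} (f : α → β)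
    (h : ∀ x y, r x y → r' (f x) (f y)) {x y : α} (hxy : Relation.EqvGen r x y) :
    Relation.EqvGen r' (f x) (f y) := by
  induction hxy with
  | rel x y h' => exact .rel _ _ (h _ _ h')
  | refl x => exact .refl _
  | symm x y _ ih => exact ih.symm
  | trans x y z _ _ ih ih' => exact ih.trans _ _ _ ih'

theorem BetaEtaConv.app {Γ : Ctx ι} {A B : Ty ι} {a a' : Term Γ (.arr A B)} {b b' : Term Γ A}
    (ha : BetaEtaConv a a') (hb : BetaEtaConv b b') : BetaEtaConv (.app a b) (.app a' b') :=
  .trans _ _ _ (eqvGen_lift (Term.app · b) (fun _ _ => .appL b) ha)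
    (eqvGen_lift (Term.app a') (fun _ _ => .appR a') hb)

theorem BetaEtaConv.lam {Γ : Ctx ι} {A B : Ty ι} {a a' : Term (A :: Γ) B}
    (ha : BetaEtaConv a a') : BetaEtaConv (.lam a) (.lam a') :=
  eqvGen_lift Term.lam (fun _ _ => .lam) ha

theorem BetaEta.subst {Γ : Ctx ι} {A : Ty ι} {a a' : Term Γ A} (h : BetaEta a a') {Δ : Ctx ι}
    (τ : ∀ A, Var Γ A → Term Δ A) : BetaEta (a.subst τ) (a'.subst τ) := by
  induction h generalizing Δ with
  | beta a b =>
    rw [← Term.subst_single_subst]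
    exact .beta _ _
  | eta a =>
    simp only [Term.subst, Term.weaken_subst]
    exact .eta _
  | appL b _ ih => exact .appL _ (ih τ)
  | appR a _ ih => exact .appR _ (ih τ)
  | lam _ ih => exact .lam (ih _)

theorem BetaEtaConv.subst_left {Γ Δ : Ctx ι} {A : Ty ι} {a a' : Term Γ A} (h : BetaEtaConv a a')
    (τ : ∀ A, Var Γ A → Term Δ A) : BetaEtaConv (a.subst τ) (a'.subst τ) :=
  eqvGen_lift (fun a : Term Γ A => a.subst τ) (fun _ _ h => h.subst τ) h

/-- A step in a value of `τ` is copied at every occurrence of the index, so it is not a single step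
of the result; the induction is on `a` instead. -/
theorem BetaEtaConv.subst_right {Γ : Ctx ι} {A : Ty ι} (a : Term Γ A) {Δ : Ctx ι}
    {τ τ' : ∀ A, Var Γ A → Term Δ A} (h : ∀ A x, BetaEtaConv (τ A x) (τ' A x)) :
    BetaEtaConv (a.subst τ) (a.subst τ') := by
  induction a generalizing Δ with
  | var x => exact h _ x
  | mvar n => exact .refl _
  | app a b iha ihb => exact (iha h).app (ihb h)
  | lam a ih =>
    refine (ih fun A x => ?_).lam
    cases x with
    | zero => exact .refl _
    | succ x =>
      simp only [liftSub, Term.weaken, Term.rename_eq_subst]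
      exact (h _ x).subst_left _

/-! ### Evaluation of `λσ`-expressions as `λ`-terms -/

/-- The values of the expressions of kind `k` in `Γ`: terms, or families of terms. -/
abbrev Kind.Value (Γ : Ctx ι) : Kind ι → Type u
  | .tm A => Term Γ A
  | .sub Δ => ∀ A, Var Δ A → Term Γ A

def consSub {Γ Δ : Ctx ι} {B : Ty ι} (b : Term Γ B) (τ : ∀ A, Var Δ A → Term Γ A) :
    ∀ A, Var (B :: Δ) A → Term Γ A
  | _, .zero => b
  | _, .succ x => τ _ x

/-- Evaluation of an expression by performing its explicit substitutions; a unification variable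
becomes the variable of the `λ`-calculus with the same name and type. -/
def Expr.eval {Γ : Ctx ι} {k : Kind ι} : Expr Γ k → k.Value Γ
  | .one => Term.var .zero
  | .mvar n => Term.mvar n
  | .app a b => Term.app a.eval b.eval
  | .lam a => Term.lam a.eval
  | .clos a s => Term.subst a.eval s.eval
  | .id => fun _ x => .var x
  | .shift => fun _ x => .var (.succ x)
  | .cons a s => consSub a.eval s.eval
  | .comp s t => fun _ x => (s.eval _ x).subst t.eval

theorem consSub_var_shift {Γ Δ : Ctx ι} {B : Ty ι} (τ : ∀ A, Var Γ A → Term Δ A) :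
    consSub (.var .zero) (fun A x => (τ A x).subst fun _ y => .var (.succ y)) = liftSub τ B := by
  funext A x
  cases x with
  | zero => rfl
  | succ x => simp only [consSub, liftSub, Term.weaken, Term.rename_eq_subst]

/-- The `σ`-rules are the laws of simultaneous substitution. The equality is syntactic, not merely
`βη`; the side condition of Eta needs this. -/
theorem SigmaRule.eval_eq {Γ : Ctx ι} {k : Kind ι} {e e' : Expr Γ k} (h : SigmaRule Γ k e e') :
    e.eval = e'.eval := by
  cases h with
  | app a b s => rfl
  | varCons a s => rfl
  | id => exact Term.subst_var _
  | abs a s => simp only [Expr.eval, Term.subst, consSub_var_shift]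
  | clos a s t => exact Term.subst_subst _ _ _
  | idL s => rfl
  | idR s => funext A x; exact Term.subst_var _
  | shiftCons a s => rfl
  | assEnv s t r => funext A x; exact Term.subst_subst _ _ _
  | mapEnv a s t => funext A x; cases x <;> rfl
  | varShift => funext A x; cases x <;> rfl
  | sCons s => funext A x; cases x <;> rfl

theorem Step.eval_eq {Γ : Ctx ι} {k : Kind ι} {e e' : Expr Γ k} (h : Step SigmaRule e e') :
    e.eval = e'.eval := by
  induction h with
  | root h => exact h.eval_eq
  | _ => simp only [Expr.eval, *]

theorem SigmaConv.eval_eq {Γ : Ctx ι} {k : Kind ι} {e e' : Expr Γ k} (h : SigmaConv e e') :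
    e.eval = e'.eval := by
  induction h with
  | rel _ _ h => exact h.eval_eq
  | refl => rfl
  | symm _ _ _ ih => exact ih.symm
  | trans _ _ _ _ _ ih ih' => exact ih.trans ih'

/-- `βη`-equality of values, pointwise on families of terms. -/
def ValueConv {Γ : Ctx ι} : (k : Kind ι) → k.Value Γ → k.Value Γ → Prop
  | .tm _ => BetaEtaConv
  | .sub Δ => fun τ τ' => ∀ A (x : Var Δ A), BetaEtaConv (τ A x) (τ' A x)

theorem ValueConv.refl {Γ : Ctx ι} {k : Kind ι} (v : k.Value Γ) : ValueConv k v v := by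
  cases k with
  | tm A => exact Relation.EqvGen.refl _
  | sub Δ => exact fun _ _ => Relation.EqvGen.refl _

theorem ValueConv.symm {Γ : Ctx ι} {k : Kind ι} {v v' : k.Value Γ} (h : ValueConv k v v') :
    ValueConv k v' v := by
  cases k with
  | tm A => exact Relation.EqvGen.symm _ _ h
  | sub Δ => exact fun A x => .symm _ _ (h A x)

theorem ValueConv.trans {Γ : Ctx ι} {k : Kind ι} {v v' v'' : k.Value Γ} (h : ValueConv k v v')
    (h' : ValueConv k v' v'') : ValueConv k v v'' := by
  cases k with
  | tm A => exact Relation.EqvGen.trans _ _ _ h h'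
  | sub Δ => exact fun A x => .trans _ _ _ (h A x) (h' A x)

theorem LambdaSigmaRule.valueConv {Γ : Ctx ι} {k : Kind ι} {e e' : Expr Γ k}
    (h : LambdaSigmaRule Γ k e e') : ValueConv k e.eval e'.eval := by
  cases h with
  | sigma h => rw [h.eval_eq]; exact .refl _
  | beta a b =>
    have h : consSub b.eval (fun _ x => .var x) = single b.eval := by
      funext A x; cases x <;> rfl
    simp only [Expr.eval, h]
    exact .rel _ _ (.beta _ _)
  | eta a b h =>
    -- The side condition of Eta holds only up to `σ`; since `σ` evaluates to identity, the function
    -- is literally a weakening and `η` applies.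
    have h' : a.eval = Term.weaken _ b.eval :=
      h.eval_eq.trans (Term.rename_eq_subst _ _).symm
    simp only [Expr.eval, h']
    exact .rel _ _ (.eta _)

theorem Step.valueConv {Γ : Ctx ι} {k : Kind ι} {e e' : Expr Γ k}
    (h : Step LambdaSigmaRule e e') : ValueConv k e.eval e'.eval := by
  induction h with
  | root h => exact h.valueConv
  | appL b _ ih => exact BetaEtaConv.app ih (.refl _)
  | appR a _ ih => exact BetaEtaConv.app (.refl _) ih
  | lam _ ih => exact BetaEtaConv.lam ih
  | closL s _ ih => exact BetaEtaConv.subst_left ih _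
  | closR a _ ih => exact BetaEtaConv.subst_right _ ih
  | consL s _ ih =>
    intro A x
    cases x with
    | zero => exact ih
    | succ x => exact .refl _
  | consR a _ ih =>
    intro A x
    cases x with
    | zero => exact .refl _
    | succ x => exact ih _ x
  | compL t _ ih => exact fun A x => (ih A x).subst_left _
  | compR s _ ih => exact fun A x => .subst_right _ ih

theorem LambdaSigmaConv.valueConv {Γ : Ctx ι} {k : Kind ι} {e e' : Expr Γ k}
    (h : LambdaSigmaConv e e') : ValueConv k e.eval e'.eval := by
  induction h with
  | rel _ _ h => exact h.valueConv
  | refl => exact .refl _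
  | symm _ _ _ ih => exact ih.symm
  | trans _ _ _ _ _ ih ih' => exact ih.trans ih'

theorem eval_varShift {Γ Θ : Ctx ι} {A : Ty ι} (x : Var Γ A) (s : Expr Θ (.sub Γ)) :
    (varShift x s).eval = s.eval A x := by
  induction x generalizing Θ with
  | zero => rfl
  | succ x ih => exact ih _

theorem eval_precookVar {Γ : Ctx ι} {A : Ty ι} (x : Var Γ A) :
    (precookVar x).eval = Term.var x := by
  cases x with
  | zero => rfl
  | succ x => exact eval_varShift _ _

theorem eval_wkShift {Γ Δ Θ : Ctx ι} (w : Wk Γ Δ) (s : Expr Θ (.sub Δ)) :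
    (wkShift w s).eval = fun A x => s.eval A (w.ren A x) := by
  induction w generalizing Θ with
  | nil => rfl
  | cons w ih => exact ih _

/-! ### Grafting -/

theorem graft_varShift (θ : Grafting ι) {Γ Θ : Ctx ι} {A : Ty ι} (x : Var Γ A)
    (s : Expr Θ (.sub Γ)) : (varShift x s).graft θ = varShift x (s.graft θ) := by
  induction x generalizing Θ with
  | zero => rfl
  | succ x ih => exact ih _

theorem graft_precookVar (θ : Grafting ι) {Γ : Ctx ι} {A : Ty ι} (x : Var Γ A) :
    (precookVar x).graft θ = precookVar x := by
  cases x with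
  | zero => rfl
  | succ x => exact graft_varShift _ _ _

theorem graft_wkShift (θ : Grafting ι) {Γ Δ Θ : Ctx ι} (w : Wk Γ Δ) (s : Expr Θ (.sub Δ)) :
    (wkShift w s).graft θ = wkShift w (s.graft θ) := by
  induction w generalizing Θ with
  | nil => rfl
  | cons w ih => exact ih _

/-- The closure `X[↑ⁿ]` left by precooking lifts the grafted value past `n` binders, exactly as
`Term.inst` does. -/
theorem eval_graft_precookAux (θ : Grafting ι) {Γ Δ : Ctx ι} {A : Ty ι} (a : Term Δ A)
    (w : Wk Γ Δ) :
    ((precookAux a w).graft θ).eval = a.inst (fun A n => (θ Γ A n).eval) w := by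
  induction a with
  | var x => simp only [precookAux, graft_precookVar, eval_precookVar, Term.inst]
  | mvar n =>
    cases w with
    | nil => exact (Term.rename_id _).symm
    | cons w =>
      simp only [precookAux, precookMVar, Expr.graft, graft_wkShift, Expr.eval, eval_wkShift,
        Term.inst, Term.rename_eq_subst, Wk.ren]
  | app a b iha ihb => simp only [precookAux, Expr.graft, Expr.eval, Term.inst, iha, ihb]
  | lam a ih => simp only [precookAux, Expr.graft, Expr.eval, Term.inst, ih]

/-- A `λσ`-solution of the precooked problem evaluates to a solution in the `λ`-calculus. -/
theorem HasSolution.of_solves_precook {Γ : Ctx ι} {T : Ty ι} {a b : Term Γ T} {θ : Grafting ι}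
    (h : Solves θ (precook a) (precook b)) : HasSolution a b := by
  refine ⟨fun A n => (θ Γ A n).eval, ?_⟩
  rw [← eval_graft_precookAux, ← eval_graft_precookAux]
  exact h.valueConv

/-- No rule mentions a unification variable, so grafting maps instances of a rule to instances of
the same rule. -/
theorem SigmaRule.graft (θ : Grafting ι) {Γ : Ctx ι} {k : Kind ι} {e e' : Expr Γ k}
    (h : SigmaRule Γ k e e') : SigmaRule Γ k (e.graft θ) (e'.graft θ) := by
  cases h <;> constructor

theorem Step.graft {R : (Γ : Ctx ι) → (k : Kind ι) → Expr Γ k → Expr Γ k → Prop}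
    (θ : Grafting ι)
    (hR : ∀ (Γ : Ctx ι) (k : Kind ι) (e e' : Expr Γ k), R Γ k e e' →
      R Γ k (e.graft θ) (e'.graft θ))
    {Γ : Ctx ι} {k : Kind ι} {e e' : Expr Γ k} (h : Step R e e') :
    Step R (e.graft θ) (e'.graft θ) := by
  induction h with
  | root h => exact .root (hR _ _ _ _ h)
  | appL b _ ih => exact .appL _ ih
  | appR a _ ih => exact .appR _ ih
  | lam _ ih => exact .lam ih
  | closL s _ ih => exact .closL _ ih
  | closR a _ ih => exact .closR _ ih
  | consL s _ ih => exact .consL _ ih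
  | consR a _ ih => exact .consR _ ih
  | compL t _ ih => exact .compL _ ih
  | compR s _ ih => exact .compR _ ih

theorem SigmaConv.graft (θ : Grafting ι) {Γ : Ctx ι} {k : Kind ι} {e e' : Expr Γ k}
    (h : SigmaConv e e') : SigmaConv (e.graft θ) (e'.graft θ) :=
  eqvGen_lift (Expr.graft θ) (fun _ _ h => h.graft θ fun _ _ _ _ h => h.graft θ) h

theorem LambdaSigmaRule.graft (θ : Grafting ι) {Γ : Ctx ι} {k : Kind ι} {e e' : Expr Γ k}
    (h : LambdaSigmaRule Γ k e e') : LambdaSigmaRule Γ k (e.graft θ) (e'.graft θ) := by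
  cases h with
  | sigma h => exact .sigma (h.graft θ)
  | beta a b => exact .beta _ _
  | eta a b h => exact .eta _ _ (h.graft θ)

theorem LambdaSigmaConv.graft (θ : Grafting ι) {Γ : Ctx ι} {k : Kind ι} {e e' : Expr Γ k}
    (h : LambdaSigmaConv e e') : LambdaSigmaConv (e.graft θ) (e'.graft θ) :=
  eqvGen_lift (Expr.graft θ) (fun _ _ h => h.graft θ fun _ _ _ _ h => h.graft θ) h

theorem Expr.graft_graft (θ θ' : Grafting ι) {Γ : Ctx ι} {k : Kind ι} (e : Expr Γ k) :
    (e.graft θ).graft θ' = e.graft fun Γ A n => (θ Γ A n).graft θ' := by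
  induction e <;> simp only [Expr.graft, *]

theorem IsNormalForm.conv {Γ : Ctx ι} {k : Kind ι} {e e' : Expr Γ k} (h : IsNormalForm e e') :
    LambdaSigmaConv e e' :=
  Relation.EqvGen.reflTransGen_le_eqvGen _ _ _ h.1

/-- Passing to normal forms does not change the solutions. -/
theorem solves_iff_of_isNormalForm {Γ : Ctx ι} {T : Ty ι} {a b a' b' : Expr Γ (.tm T)}
    {θ : Grafting ι} (ha : IsNormalForm a a') (hb : IsNormalForm b b') :
    Solves θ a' b' ↔ Solves θ a b :=
  ⟨fun h => .trans _ _ _ (ha.conv.graft θ) (.trans _ _ _ h (.symm _ _ (hb.conv.graft θ))),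
    fun h => .trans _ _ _ (.symm _ _ (ha.conv.graft θ)) (.trans _ _ _ h (hb.conv.graft θ))⟩

/-! ### `λσ`-equality is a congruence -/

theorem SigmaRule.conv {Γ : Ctx ι} {k : Kind ι} {e e' : Expr Γ k} (h : SigmaRule Γ k e e') :
    LambdaSigmaConv e e' :=
  .rel _ _ (.root (.sigma h))

namespace LambdaSigmaConv

theorem refl {Γ : Ctx ι} {k : Kind ι} (e : Expr Γ k) : LambdaSigmaConv e e :=
  Relation.EqvGen.refl e

theorem symm {Γ : Ctx ι} {k : Kind ι} {e e' : Expr Γ k} (h : LambdaSigmaConv e e') :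
    LambdaSigmaConv e' e :=
  Relation.EqvGen.symm _ _ h

theorem trans {Γ : Ctx ι} {k : Kind ι} {e e' e'' : Expr Γ k} (h : LambdaSigmaConv e e')
    (h' : LambdaSigmaConv e' e'') : LambdaSigmaConv e e'' :=
  Relation.EqvGen.trans _ _ _ h h'

instance {Γ : Ctx ι} {k : Kind ι} :
    Trans (LambdaSigmaConv (Γ := Γ) (k := k)) LambdaSigmaConv LambdaSigmaConv := ⟨trans⟩

theorem app {Γ : Ctx ι} {A B : Ty ι} {a a' : Expr Γ (.tm (.arr A B))} {b b' : Expr Γ (.tm A)}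
    (ha : LambdaSigmaConv a a') (hb : LambdaSigmaConv b b') :
    LambdaSigmaConv (.app a b) (.app a' b') :=
  (eqvGen_lift (Expr.app · b) (fun _ _ => Step.appL b) ha).trans _ _ _
    (eqvGen_lift (Expr.app a') (fun _ _ => Step.appR a') hb)

theorem lam {Γ : Ctx ι} {A B : Ty ι} {a a' : Expr (A :: Γ) (.tm B)}
    (ha : LambdaSigmaConv a a') : LambdaSigmaConv (.lam a) (.lam a') :=
  eqvGen_lift Expr.lam (fun _ _ => Step.lam) ha

theorem clos {Γ Δ : Ctx ι} {A : Ty ι} {a a' : Expr Δ (.tm A)} {s s' : Expr Γ (.sub Δ)}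
    (ha : LambdaSigmaConv a a') (hs : LambdaSigmaConv s s') :
    LambdaSigmaConv (.clos a s) (.clos a' s') :=
  (eqvGen_lift (Expr.clos · s) (fun _ _ => Step.closL s) ha).trans _ _ _
    (eqvGen_lift (Expr.clos a') (fun _ _ => Step.closR a') hs)

theorem comp {Γ Δ Θ : Ctx ι} {s s' : Expr Δ (.sub Θ)} {t t' : Expr Γ (.sub Δ)}
    (hs : LambdaSigmaConv s s') (ht : LambdaSigmaConv t t') :
    LambdaSigmaConv (.comp s t) (.comp s' t') :=
  (eqvGen_lift (Expr.comp · t) (fun _ _ => Step.compL t) hs).trans _ _ _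
    (eqvGen_lift (Expr.comp s') (fun _ _ => Step.compR s') ht)

end LambdaSigmaConv

/-! ### Precooking and explicit substitutions -/

/-- `wkShift` accumulates `s` at the inner end of a right-nested composition; pulling it out by
associativity allows inductions on `w`. -/
theorem wkShift_conv {Γ Δ Θ : Ctx ι} (w : Wk Γ Δ) (s : Expr Θ (.sub Δ)) :
    LambdaSigmaConv (wkShift w s) (.comp (wkShift w .id) s) := by
  induction w generalizing Θ with
  | nil => exact (SigmaRule.idL s).conv.symm
  | cons w ih =>
    calc LambdaSigmaConv (wkShift w (.comp .shift s)) _ := ih _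
      LambdaSigmaConv _ (.comp (wkShift w .id) (.comp (.comp .shift .id) s)) :=
        .comp (.refl _) (.comp (SigmaRule.idR _).conv.symm (.refl _))
      LambdaSigmaConv _ (.comp (.comp (wkShift w .id) (.comp .shift .id)) s) :=
        (SigmaRule.assEnv _ _ _).conv.symm
      LambdaSigmaConv _ _ := .comp (ih _).symm (.refl _)

theorem wkShift_cons_conv {Γ Δ : Ctx ι} {A : Ty ι} (w : Wk Γ Δ) :
    LambdaSigmaConv (wkShift (.cons (A := A) w) .id) (.comp (wkShift w .id) .shift) :=
  (wkShift_conv w _).trans (.comp (.refl _) (SigmaRule.idR _).conv)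

/-- A uniform form without the case split that precooking makes to avoid `X[id]`. -/
theorem precookMVar_conv {Γ Δ : Ctx ι} {A : Ty ι} (m : ℕ) (w : Wk Γ Δ) :
    LambdaSigmaConv (precookMVar m w : Expr Δ (.tm A))
      (.clos (.mvar m : Expr Γ (.tm A)) (wkShift w .id)) := by
  cases w with
  | nil => exact (SigmaRule.id _).conv.symm
  | cons w => exact .clos (.refl _) ((wkShift_conv w _).trans (wkShift_cons_conv w).symm)

theorem varShift_conv {Γ Θ : Ctx ι} {A : Ty ι} (x : Var Γ A) (s : Expr Θ (.sub Γ)) :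
    LambdaSigmaConv (varShift x s) (.clos (precookVar x) s) := by
  induction x generalizing Θ with
  | zero => exact .refl _
  | succ x ih =>
    calc LambdaSigmaConv (varShift x (.comp .shift s)) _ := ih _
      LambdaSigmaConv _ (.clos (.clos (precookVar x) .shift) s) :=
        (SigmaRule.clos _ _ _).conv.symm
      LambdaSigmaConv _ (.clos (varShift x .shift) s) := .clos (ih _).symm (.refl _)

theorem precookVar_succ_conv {Γ : Ctx ι} {A B : Ty ι} (x : Var Γ A) :
    LambdaSigmaConv (precookVar (.succ (B := B) x)) (.clos (precookVar x) .shift) :=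
  varShift_conv _ _

/-- The explicit substitution `s` is compatible with the ambient weakenings `w` and `w'`: it fixes
the variables of the ambient context. -/
def WkCompat {Γ Δ Δ' : Ctx ι} (w : Wk Γ Δ) (w' : Wk Γ Δ') (s : Expr Δ' (.sub Δ)) : Prop :=
  LambdaSigmaConv (.comp (wkShift w .id) s) (wkShift w' .id)

/-- The explicit substitution `1.(s ∘ ↑)`. -/
abbrev liftExpr {Δ Δ' : Ctx ι} (s : Expr Δ' (.sub Δ)) (B : Ty ι) :
    Expr (B :: Δ') (.sub (B :: Δ)) :=
  .cons .one (.comp s .shift)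

theorem WkCompat.lift {Γ Δ Δ' : Ctx ι} {w : Wk Γ Δ} {w' : Wk Γ Δ'} {s : Expr Δ' (.sub Δ)}
    (h : WkCompat w w' s) (B : Ty ι) : WkCompat w.cons w'.cons (liftExpr s B) :=
  calc LambdaSigmaConv (.comp (wkShift w.cons .id) (liftExpr s B))
        (.comp (.comp (wkShift w .id) .shift) (liftExpr s B)) :=
        .comp (wkShift_cons_conv w) (.refl _)
    LambdaSigmaConv _ (.comp (wkShift w .id) (.comp .shift (liftExpr s B))) :=
      (SigmaRule.assEnv _ _ _).conv
    LambdaSigmaConv _ (.comp (wkShift w .id) (.comp s .shift)) :=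
      .comp (.refl _) (SigmaRule.shiftCons _ _).conv
    LambdaSigmaConv _ (.comp (.comp (wkShift w .id) s) .shift) :=
      (SigmaRule.assEnv _ _ _).conv.symm
    LambdaSigmaConv _ (.comp (wkShift w' .id) .shift) := .comp h (.refl _)
    LambdaSigmaConv _ _ := (wkShift_cons_conv w').symm

/-- Unification variables are inert in the `λ`-calculus but carry a closure in `λσ`; compatibility
makes `s` turn one shift into the other. -/
theorem WkCompat.precookMVar {Γ Δ Δ' : Ctx ι} {w : Wk Γ Δ} {w' : Wk Γ Δ'} {s : Expr Δ' (.sub Δ)}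
    (h : WkCompat w w' s) {A : Ty ι} (m : ℕ) :
    LambdaSigmaConv (precookMVar m w' : Expr Δ' (.tm A)) (.clos (precookMVar m w) s) :=
  calc LambdaSigmaConv (LambdaSigma.precookMVar m w' : Expr Δ' (.tm A)) _ := precookMVar_conv m w'
    LambdaSigmaConv _ (.clos (.mvar m) (.comp (wkShift w .id) s)) := .clos (.refl _) h.symm
    LambdaSigmaConv _ (.clos (.clos (.mvar m) (wkShift w .id)) s) :=
      (SigmaRule.clos _ _ _).conv.symm
    LambdaSigmaConv _ _ := .clos (precookMVar_conv m w).symm (.refl _)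

theorem precookVar_succ_lift {Δ Δ' : Ctx ι} (s : Expr Δ' (.sub Δ)) {A : Ty ι} (B : Ty ι)
    (x : Var Δ A) :
    LambdaSigmaConv (.clos (.clos (precookVar x) s) .shift)
      (.clos (precookVar x.succ) (liftExpr s B)) :=
  calc LambdaSigmaConv (.clos (.clos (precookVar x) s) .shift)
        (.clos (precookVar x) (.comp s .shift)) := (SigmaRule.clos _ _ _).conv
    LambdaSigmaConv _ (.clos (precookVar x) (.comp .shift (liftExpr s B))) :=
      .clos (.refl _) (SigmaRule.shiftCons _ _).conv.symm
    LambdaSigmaConv _ (.clos (.clos (precookVar x) .shift) (liftExpr s B)) :=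
      (SigmaRule.clos _ _ _).conv.symm
    LambdaSigmaConv _ _ := .clos (precookVar_succ_conv x).symm (.refl _)

theorem precookAux_rename {Γ Δ : Ctx ι} {A : Ty ι} (a : Term Δ A) {Δ' : Ctx ι} {w : Wk Γ Δ}
    {w' : Wk Γ Δ'} {ρ : ∀ A, Var Δ A → Var Δ' A} {s : Expr Δ' (.sub Δ)} (hw : WkCompat w w' s)
    (hρ : ∀ A x, LambdaSigmaConv (precookVar (ρ A x)) (.clos (precookVar x) s)) :
    LambdaSigmaConv (precookAux (a.rename ρ) w') (.clos (precookAux a w) s) := by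
  induction a generalizing Δ' with
  | var x => exact hρ _ x
  | mvar m => exact hw.precookMVar m
  | app a b iha ihb => exact ((iha hw hρ).app (ihb hw hρ)).trans (SigmaRule.app _ _ _).conv.symm
  | lam a ih =>
    refine (LambdaSigmaConv.lam (ih (hw.lift _) fun A x => ?_)).trans
      (SigmaRule.abs _ _).conv.symm
    cases x with
    | zero => exact (SigmaRule.varCons _ _).conv.symm
    | succ x =>
      exact (precookVar_succ_conv _).trans
        ((LambdaSigmaConv.clos (hρ _ x) (.refl _)).trans (precookVar_succ_lift s _ x))

theorem precookAux_weaken {Γ Δ : Ctx ι} {A : Ty ι} (a : Term Δ A) (w : Wk Γ Δ) (B : Ty ι) :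
    LambdaSigmaConv (precookAux (a.weaken B) w.cons) (.clos (precookAux a w) .shift) :=
  precookAux_rename a (wkShift_cons_conv w).symm fun _ x => precookVar_succ_conv x

theorem precookVar_wkRen {Γ Δ : Ctx ι} {A : Ty ι} (w : Wk Γ Δ) (x : Var Γ A) :
    LambdaSigmaConv (precookVar (w.ren A x)) (.clos (precookVar x) (wkShift w .id)) := by
  induction w with
  | nil => exact (SigmaRule.id _).conv.symm
  | cons w ih =>
    calc LambdaSigmaConv (precookVar (w.ren A x).succ) _ := precookVar_succ_conv _
      LambdaSigmaConv _ _ := .clos ih (.refl _)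
      LambdaSigmaConv _ _ := (SigmaRule.clos _ _ _).conv
      LambdaSigmaConv _ _ := .clos (.refl _) (wkShift_cons_conv w).symm

theorem precookAux_wkRen {Γ Δ : Ctx ι} {A : Ty ι} (a : Term Γ A) (w : Wk Γ Δ) :
    LambdaSigmaConv (precookAux (a.rename w.ren) w) (.clos (precook a) (wkShift w .id)) :=
  precookAux_rename a (SigmaRule.idL _).conv fun _ x => precookVar_wkRen w x

/-- Same induction as for renamings, which are needed first: under a binder the values of `τ` are
weakened, and `precookAux_weaken` handles them. -/
theorem precookAux_subst {Γ Δ : Ctx ι} {A : Ty ι} (a : Term Δ A) {Δ' : Ctx ι} {w : Wk Γ Δ}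
    {w' : Wk Γ Δ'} {τ : ∀ A, Var Δ A → Term Δ' A} {s : Expr Δ' (.sub Δ)} (hw : WkCompat w w' s)
    (hτ : ∀ A x, LambdaSigmaConv (precookAux (τ A x) w') (.clos (precookVar x) s)) :
    LambdaSigmaConv (precookAux (a.subst τ) w') (.clos (precookAux a w) s) := by
  induction a generalizing Δ' with
  | var x => exact hτ _ x
  | mvar m => exact hw.precookMVar m
  | app a b iha ihb => exact ((iha hw hτ).app (ihb hw hτ)).trans (SigmaRule.app _ _ _).conv.symm
  | lam a ih =>
    refine (LambdaSigmaConv.lam (ih (hw.lift _) fun A x => ?_)).trans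
      (SigmaRule.abs _ _).conv.symm
    cases x with
    | zero => exact (SigmaRule.varCons _ _).conv.symm
    | succ x =>
      exact (precookAux_weaken _ _ _).trans
        ((LambdaSigmaConv.clos (hτ _ x) (.refl _)).trans (precookVar_succ_lift s _ x))

/-- Matches `β` with Beta; `b.id` cancels the last shift of `w.cons`, so the ambient context is
fixed. -/
theorem precookAux_single {Γ Δ : Ctx ι} {A B : Ty ι} (a : Term (A :: Δ) B) (b : Term Δ A)
    (w : Wk Γ Δ) :
    LambdaSigmaConv (precookAux (a.subst (single b)) w)
      (.clos (precookAux a w.cons) (.cons (precookAux b w) .id)) := by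
  refine precookAux_subst a ?_ fun C x => ?_
  · calc LambdaSigmaConv (.comp (wkShift w.cons .id) (.cons (precookAux b w) .id)) _ :=
          .comp (wkShift_cons_conv w) (.refl _)
      LambdaSigmaConv _ _ := (SigmaRule.assEnv _ _ _).conv
      LambdaSigmaConv _ _ := .comp (.refl _) (SigmaRule.shiftCons _ _).conv
      LambdaSigmaConv _ _ := (SigmaRule.idR _).conv
  · cases x with
    | zero => exact (SigmaRule.varCons _ _).conv.symm
    | succ x =>
      refine LambdaSigmaConv.symm ?_
      calc LambdaSigmaConv (.clos (precookVar x.succ) (.cons (precookAux b w) .id)) _ :=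
            .clos (precookVar_succ_conv x) (.refl _)
        LambdaSigmaConv _ _ := (SigmaRule.clos _ _ _).conv
        LambdaSigmaConv _ _ := .clos (.refl _) (SigmaRule.shiftCons _ _).conv
        LambdaSigmaConv _ _ := (SigmaRule.id _).conv

theorem precookAux_eta {Γ Δ : Ctx ι} {A B : Ty ι} (a : Term Δ (.arr A B)) (w : Wk Γ Δ) :
    LambdaSigmaConv (precookAux (.lam (.app (a.weaken A) (.var .zero))) w) (precookAux a w) :=
  -- The precooked weakening is first converted to a literal closure by `↑`, so that Eta applies
  -- with a reflexive side condition.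
  (LambdaSigmaConv.lam ((precookAux_weaken a w A).app (.refl _))).trans
    (.rel _ _ (.root (.eta _ _ (.refl _))))

theorem BetaEta.precookAux {Γ Δ : Ctx ι} {A : Ty ι} {a b : Term Δ A} (h : BetaEta a b)
    (w : Wk Γ Δ) : LambdaSigmaConv (precookAux a w) (precookAux b w) := by
  induction h with
  | beta a b =>
    exact LambdaSigmaConv.trans (.rel _ _ (.root (.beta _ _))) (precookAux_single a b w).symm
  | eta a => exact precookAux_eta a w
  | appL b _ ih => exact (ih w).app (.refl _)
  | appR a _ ih => exact .app (.refl _) (ih w)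
  | lam _ ih => exact (ih w.cons).lam

theorem BetaEtaConv.precook {Γ : Ctx ι} {A : Ty ι} {a b : Term Γ A} (h : BetaEtaConv a b) :
    LambdaSigmaConv (precook a) (precook b) := by
  induction h with
  | rel _ _ h => exact h.precookAux .nil
  | refl => exact .refl _
  | symm _ _ _ ih => exact ih.symm
  | trans _ _ _ _ _ ih ih' => exact ih.trans ih'

/-! ### Precooking and instantiation -/

theorem mvars_varShift {Γ Θ : Ctx ι} {A : Ty ι} (x : Var Γ A) (s : Expr Θ (.sub Γ)) :
    (varShift x s).mvars = s.mvars := by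
  induction x generalizing Θ with
  | zero => simp [varShift, Expr.mvars]
  | succ x ih => simp [varShift, ih, Expr.mvars]

theorem mvars_precookVar {Γ : Ctx ι} {A : Ty ι} (x : Var Γ A) : (precookVar x).mvars = ∅ := by
  cases x with
  | zero => rfl
  | succ x => exact mvars_varShift _ _

theorem mvars_wkShift {Γ Δ Θ : Ctx ι} (w : Wk Γ Δ) (s : Expr Θ (.sub Δ)) :
    (wkShift w s).mvars = s.mvars := by
  induction w generalizing Θ with
  | nil => rfl
  | cons w ih => simp [wkShift, ih, Expr.mvars]

theorem mvars_precookMVar {Γ Δ : Ctx ι} {A : Ty ι} (m : ℕ) (w : Wk Γ Δ) :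
    (precookMVar m w : Expr Δ (.tm A)).mvars = {⟨m, Γ, A⟩} := by
  cases w <;> simp [precookMVar, Expr.mvars, mvars_wkShift]

/-- The unification variables of a precooked term have the ambient context. -/
theorem ctx_eq_of_mem_mvars_precookAux {Γ Δ : Ctx ι} {A : Ty ι} (a : Term Δ A) (w : Wk Γ Δ)
    {X : MVar ι} (hX : X ∈ (precookAux a w).mvars) : X.ctx = Γ := by
  induction a with
  | var x => simp [precookAux, mvars_precookVar] at hX
  | mvar m =>
    rw [precookAux, mvars_precookMVar] at hX
    rw [hX]
  | app a b iha ihb => exact hX.elim (iha w) (ihb w)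
  | lam a ih => exact ih w.cons hX

/-- Grafting in a precooked term simulates the instantiation of the `λ`-term. -/
theorem graft_precookAux {Γ Δ : Ctx ι} {A : Ty ι} (a : Term Δ A) (w : Wk Γ Δ) (θ : Grafting ι)
    (θ' : ∀ A : Ty ι, ℕ → Term Γ A)
    (h : ∀ A n, ⟨n, Γ, A⟩ ∈ (precookAux a w).mvars →
      LambdaSigmaConv (θ Γ A n) (precook (θ' A n))) :
    LambdaSigmaConv ((precookAux a w).graft θ) (precookAux (a.inst θ' w) w) := by
  induction a with
  | var x => rw [precookAux, graft_precookVar]; exact .refl _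
  | mvar m =>
    have h' := h _ m (by rw [precookAux, mvars_precookMVar]; rfl)
    refine ((precookMVar_conv m w).graft θ).trans ?_
    rw [Expr.graft, graft_wkShift]
    exact (LambdaSigmaConv.clos h' (.refl _)).trans (precookAux_wkRen _ w).symm
  | app a b iha ihb =>
    exact (iha w fun A n hn => h A n (.inl hn)).app (ihb w fun A n hn => h A n (.inr hn))
  | lam a ih => exact (ih w.cons h).lam

/-! ### The `η`-expanded body of a term -/

/-- For `t` of type `A₁ → ⋯ → Aₙ → B` with `B` atomic, the body `t⁺ n ⋯ 1` of its `η`-expansion. -/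
def etaBody : (A : Ty ι) → {Γ : Ctx ι} → Term Γ A → Term (A.bodyCtx Γ) (.base A.target)
  | .base _, _, t => t
  | .arr A B, _, t => etaBody B (.app (t.weaken A) (.var .zero))

/-- The body of `λ_{A₁} ⋯ λ_{Aₙ}` lies below `n` more binders. -/
def bodyWk {Γ : Ctx ι} : (A : Ty ι) → {Δ : Ctx ι} → Wk Γ Δ → Wk Γ (A.bodyCtx Δ)
  | .base _, _, w => w
  | .arr _ B, _, w => bodyWk B w.cons

/-- Eta is used once for each argument type, the innermost abstraction being removed first. -/
theorem lams_precookAux_etaBody {Γ Δ : Ctx ι} (A : Ty ι) (t : Term Δ A) (w : Wk Γ Δ) :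
    LambdaSigmaConv (lams A (precookAux (etaBody A t) (bodyWk A w))) (precookAux t w) := by
  induction A generalizing Δ with
  | base i => exact .refl _
  | arr A B _ ih => exact (LambdaSigmaConv.lam (ih _ w.cons)).trans (precookAux_eta t w)

theorem graft_lams (θ : Grafting ι) (A : Ty ι) {Γ : Ctx ι}
    (c : Expr (A.bodyCtx Γ) (.tm (.base A.target))) :
    (lams A c).graft θ = lams A (c.graft θ) := by
  induction A generalizing Γ with
  | base i => rfl
  | arr A B _ ih => exact congrArg Expr.lam (ih c)

/-! ### Precooked terms are simple and `σ`-normal -/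

theorem IsShiftPow.isSimple {n : ℕ} {Γ Δ : Ctx ι} {s : Expr Γ (.sub Δ)} (h : IsShiftPow n s) :
    s.IsSimple := by
  induction h with
  | zero => trivial
  | one => trivial
  | succ _ ih => exact ⟨trivial, ih⟩

theorem isShiftPow_wkShift {n : ℕ} {Γ Δ Θ : Ctx ι} (w : Wk Γ Δ) {s : Expr Θ (.sub Δ)}
    (h : IsShiftPow (n + 1) s) : ∃ m, IsShiftPow (m + 1) (wkShift w s) := by
  induction w generalizing Θ n with
  | nil => exact ⟨n, h⟩
  | cons w ih => exact ih h.succ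

theorem exists_varShift_eq {n : ℕ} {Γ Θ : Ctx ι} {A : Ty ι} (x : Var Γ A) {s : Expr Θ (.sub Γ)}
    (h : IsShiftPow (n + 1) s) :
    ∃ (m : ℕ) (Δ : Ctx ι) (t : Expr Θ (.sub (A :: Δ))),
      IsShiftPow (m + 1) t ∧ varShift x s = .clos .one t := by
  induction x generalizing Θ n with
  | zero => exact ⟨n, _, s, h, rfl⟩
  | succ x ih => exact ih h.succ

theorem isSigmaNormal_shift {Γ : Ctx ι} {A : Ty ι} :
    IsSigmaNormal (.shift : Expr (A :: Γ) (.sub Γ)) := by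
  rintro e' (h | _)
  cases h

/-- A redex at the root of `↑ ∘ s` needs `s = id` or `s` a cons, and a positive power of `↑` is
neither. -/
theorem IsShiftPow.isSigmaNormal {n : ℕ} {Γ Δ : Ctx ι} {s : Expr Γ (.sub Δ)}
    (h : IsShiftPow (n + 1) s) : IsSigmaNormal s := by
  generalize hm : n + 1 = m at h
  induction h generalizing n with
  | zero => cases hm
  | one => exact isSigmaNormal_shift
  | succ h ih =>
    intro e' h'
    cases h' with
    | root h' =>
      cases h' <;> cases h
    | compL _ h' => exact isSigmaNormal_shift _ h'
    | compR _ h' => exact ih rfl _ h'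

theorem isSigmaNormal_one {Γ : Ctx ι} {A : Ty ι} :
    IsSigmaNormal (.one : Expr (A :: Γ) (.tm A)) := by
  rintro e' (h | _)
  cases h

theorem isSigmaNormal_mvar {Γ : Ctx ι} {A : Ty ι} (n : ℕ) :
    IsSigmaNormal (.mvar n : Expr Γ (.tm A)) := by
  rintro e' (h | _)
  cases h

/-- The exponent must be positive: `1[id]` is a redex of the rule Id. -/
theorem IsShiftPow.isSigmaNormal_clos_one {n : ℕ} {Γ Δ : Ctx ι} {A : Ty ι}
    {s : Expr Γ (.sub (A :: Δ))} (h : IsShiftPow (n + 1) s) : IsSigmaNormal (.clos .one s) := by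
  intro e' h'
  cases h' with
  | root h' => cases h' <;> cases h
  | closL _ h' => exact isSigmaNormal_one _ h'
  | closR _ h' => exact h.isSigmaNormal _ h'

theorem IsShiftPow.isSigmaNormal_clos_mvar {n : ℕ} {Γ Δ : Ctx ι} {A : Ty ι}
    {s : Expr Γ (.sub Δ)} (h : IsShiftPow (n + 1) s) (m : ℕ) :
    IsSigmaNormal (.clos (.mvar m : Expr Δ (.tm A)) s) := by
  intro e' h'
  cases h' with
  | root h' =>
      cases h'
      cases h
  | closL _ h' => exact isSigmaNormal_mvar _ _ h'
  | closR _ h' => exact h.isSigmaNormal _ h'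

/-- No `σ`-rule has an application or abstraction at its root, so only the closures matter. Redexes
of Beta and Eta may remain. -/
theorem isSimple_isSigmaNormal_precookAux {Γ Δ : Ctx ι} {A : Ty ι} (a : Term Δ A) (w : Wk Γ Δ) :
    (precookAux a w).IsSimple ∧ IsSigmaNormal (precookAux a w) := by
  induction a with
  | var x =>
    cases x with
    | zero => exact ⟨trivial, isSigmaNormal_one⟩
    | succ x =>
      obtain ⟨m, Δ, t, ht, h⟩ := exists_varShift_eq x .one
      rw [precookAux, precookVar, h]
      exact ⟨⟨False.elim, trivial, ht.isSimple⟩, ht.isSigmaNormal_clos_one⟩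
  | mvar m =>
    cases w with
    | nil => exact ⟨trivial, isSigmaNormal_mvar m⟩
    | cons w =>
      obtain ⟨k, hk⟩ := isShiftPow_wkShift w .one
      exact ⟨⟨fun _ => ⟨_, hk⟩, trivial, hk.isSimple⟩, hk.isSigmaNormal_clos_mvar m⟩
  | app a b iha ihb =>
    refine ⟨⟨(iha w).1, (ihb w).1⟩, fun e' h => ?_⟩
    cases h with
    | root h => cases h
    | appL _ h => exact (iha w).2 _ h
    | appR _ h => exact (ihb w).2 _ h
  | lam a ih =>
    refine ⟨(ih w.cons).1, fun e' h => ?_⟩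
    cases h with
    | root h => cases h
    | lam h => exact (ih w.cons).2 _ h

/-! ### Solving for the new variables -/

/-- A grafting with prescribed values at the new variables; every other variable is fixed. -/
theorem exists_grafting {y : MVar ι → ℕ} {V : Set (MVar ι)} (hV : Set.InjOn (bodyVar y) V)
    (F : ∀ X : MVar ι, Expr (X.ty.bodyCtx X.ctx) (.tm (.base X.ty.target)))
    (P : ∀ {Γ : Ctx ι} {A : Ty ι}, Expr Γ (.tm A) → Prop) (hF : ∀ X ∈ V, P (F X))
    (hP : ∀ (Γ : Ctx ι) (A : Ty ι) (n : ℕ), P (.mvar n : Expr Γ (.tm A))) :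
    ∃ θ : Grafting ι, (∀ Γ A n, P (θ Γ A n)) ∧ ∀ X ∈ V, θ _ _ (y X) = F X := by
  classical
  -- Bundling name and sort in `Z` fixes the type of the value; by injectivity at most one `X` in
  -- `V` prescribes it, up to transport along `bodyVar y X = Z`.
  have h (Z : MVar ι) : ∃ e : Expr Z.ctx (.tm Z.ty), P e ∧
      ∀ X ∈ V, ∀ hX : bodyVar y X = Z, hX ▸ F X = e := by
    by_cases hZ : ∃ X ∈ V, bodyVar y X = Z
    · obtain ⟨X, hX, rfl⟩ := hZ
      refine ⟨F X, hF X hX, fun X' hX' h => ?_⟩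
      obtain rfl := hV hX' hX h
      rfl
    · exact ⟨.mvar Z.name, hP _ _ _, fun X hX h => (hZ ⟨X, hX, h⟩).elim⟩
  choose e he he' using h
  exact ⟨fun Γ A n => e ⟨n, Γ, A⟩, fun _ _ _ => he _, fun X hX => (he' _ X hX rfl).symm⟩

/-- A solution in the `λ`-calculus gives a simple `σ`-normal solution for the new variables. -/
theorem HasSolution.exists_solves {Γ : Ctx ι} {T : Ty ι} {a b : Term Γ T} (h : HasSolution a b)
    {y : MVar ι → ℕ} {V : Set (MVar ι)} (hV : Set.InjOn (bodyVar y) V)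
    (ha : (precook a).mvars ⊆ V) (hb : (precook b).mvars ⊆ V) (hctx : ∀ X ∈ V, X.ctx = Γ) :
    ∃ θ : Grafting ι, (θ.IsSimple ∧ ∀ Δ A n, IsSigmaNormal (θ Δ A n)) ∧
      Solves θ ((precook a).graft (expand y V)) ((precook b).graft (expand y V)) := by
  obtain ⟨τ, hτ⟩ := h
  -- `τ` gives terms of context `Γ`, but `X` carries its own context: hence the transport, and a
  -- dummy value when the contexts differ.
  have hF (X : MVar ι) : ∃ e : Expr (X.ty.bodyCtx X.ctx) (.tm (.base X.ty.target)),
      (X.ctx = Γ → e.IsSimple ∧ IsSigmaNormal e) ∧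
        ∀ h : Γ = X.ctx, LambdaSigmaConv (lams X.ty e) (precook (h ▸ τ X.ty X.name)) := by
    obtain ⟨n, Δ, A⟩ := X
    by_cases hΔ : Δ = Γ
    · subst hΔ
      exact ⟨precookAux (etaBody A (τ A n)) (bodyWk A .nil),
        fun _ => isSimple_isSigmaNormal_precookAux _ _,
        fun _ => lams_precookAux_etaBody A (τ A n) .nil⟩
    · exact ⟨.mvar 0, fun h => (hΔ h).elim, fun h => (hΔ h.symm).elim⟩
  choose F hF hF' using hF
  obtain ⟨θ, hθ, hθF⟩ := exists_grafting hV F (fun e => e.IsSimple ∧ IsSigmaNormal e)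
    (fun X hX => hF X (hctx X hX)) fun _ _ n => ⟨trivial, isSigmaNormal_mvar n⟩
  -- Expansion followed by `θ` sends `X` to the abstraction of `F X`, which is convertible to the
  -- precooking of `τ X`.
  have key (c : Term Γ T) (hc : (precook c).mvars ⊆ V) :
      LambdaSigmaConv (((precook c).graft (expand y V)).graft θ) (precook (c.inst τ .nil)) := by
    rw [Expr.graft_graft]
    refine graft_precookAux c .nil _ τ fun A n hn => ?_
    have hn' := hc hn
    simp only [expand, if_pos hn', graft_lams, Expr.graft]
    rw [show θ _ _ (y ⟨n, Γ, A⟩) = F ⟨n, Γ, A⟩ from hθF _ hn']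
    exact hF' ⟨n, Γ, A⟩ rfl
  exact ⟨θ, ⟨fun Δ A n => (hθ Δ A n).1, fun Δ A n => (hθ Δ A n).2⟩,
    (key a ha).trans (hτ.precook.trans (key b hb).symm)⟩

end LambdaSigma

theorem mainTheorem3 {ι : Type*} {Γ : Ctx ι} {T : Ty ι} (a b : Term Γ T)
    (y : MVar ι → ℕ) (hy : IsFresh y ((precook a).mvars ∪ (precook b).mvars))
    (a' b' : Expr Γ (.tm T))
    (ha' : IsNormalForm
      ((precook a).graft (expand y ((precook a).mvars ∪ (precook b).mvars))) a')
    (hb' : IsNormalForm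
      ((precook b).graft (expand y ((precook a).mvars ∪ (precook b).mvars))) b') :
    List.TFAE [
      HasSolution a b,
      ∃ θ : Grafting ι, θ.IsSimple ∧ Solves θ a' b',
      ∃ θ : Grafting ι, (θ.IsSimple ∧ ∀ Δ A n, IsSigmaNormal (θ Δ A n)) ∧ Solves θ a' b'] := by
  tfae_have 1 → 3 := fun h => by
    obtain ⟨θ, hθ, hs⟩ := h.exists_solves hy.1 Set.subset_union_left Set.subset_union_right
      fun X hX => hX.elim (ctx_eq_of_mem_mvars_precookAux a .nil)
        (ctx_eq_of_mem_mvars_precookAux b .nil)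
    exact ⟨θ, hθ, (solves_iff_of_isNormalForm ha' hb').2 hs⟩
  tfae_have 3 → 2 := fun ⟨θ, hθ, hs⟩ => ⟨θ, hθ.1, hs⟩
  tfae_have 2 → 1 := fun ⟨θ, _, hs⟩ => by
    have hs' := (solves_iff_of_isNormalForm ha' hb').1 hs
    -- Expansion followed by `θ` is a single grafting that solves the original precooked problem.
    rw [Solves, Expr.graft_graft, Expr.graft_graft] at hs'
    exact HasSolution.of_solves_precook hs'
  tfae_finish
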